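/- Let $\mathbb{N}=\{1,2,3,\dots\}$. Let $G=(V,E)$ be a finite simple graph with $m$ edges. An AR-labeling of $G$ is an injective map $f:E\to\mathbb{N}$ such that, for every vertex $v$, distinct subsets of the set of edges incident on $v$ have distinct sums of labels. $G$ is an AR-graph if it has an AR-labeling with values in $\{1,2,\dots,m\}$. For $r\ge 1$ and $t\ge 2$, the perfect $t$-ary tree $T_{r,t}$ is the rooted tree in which every interior node has exactly $t$ children and all leaves have depth $r$. The generalized glued $t$-ary tree $GT_{r,t}^{(n)}$ is obtained from $n\ge 1$ copies of $T_{r,t}$ by identifying, for each leaf of $T_{r,t}$, the $n$ copies of that leaf (so $GT_{r,t}^{(1)}=T_{r,t}$). **Theorem.** For all integers $r\ge 1$ and $1\le n\le 4$ with $(n,r)\ne(1,1)$, the generalized glued ternary tree $GT_{r,3}^{(n)}$ is an AR-graph. -/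

import Mathlib

/-- A vertex `v` is an AR-vertex under the edge labeling `f` if distinct sets of edges incident
on `v` have distinct label sums. -/
def IsARVertex {V : Type*} (G : SimpleGraph V) (f : G.edgeSet → ℕ) (v : V) : Prop :=
  ∀ S T : Finset G.edgeSet, (∀ e ∈ S, v ∈ e.1) → (∀ e ∈ T, v ∈ e.1) →
    ∑ e ∈ S, f e = ∑ e ∈ T, f e → S = T

/-- An AR-labeling: an injective edge labeling by positive integers under which every vertex is
an AR-vertex. -/
def IsARLabeling {V : Type*} (G : SimpleGraph V) (f : G.edgeSet → ℕ) : Prop :=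
  (∀ e, 0 < f e) ∧ Function.Injective f ∧ ∀ v, IsARVertex G f v

/-- A finite graph with `m` edges is an AR-graph if it has an AR-labeling with all labels
in `{1, …, m}`. -/
def IsARGraph {V : Type*} [Finite V] (G : SimpleGraph V) : Prop :=
  ∃ f : G.edgeSet → ℕ, IsARLabeling G f ∧ ∀ e, f e ≤ Nat.card G.edgeSet

/-- The nodes of the perfect `t`-ary tree of depth `r`: words of length at most `r` over an
alphabet with `t` letters. The root is the empty word, the children of a word `w` are the words
`a :: w`, the depth of a node is the length of the word, and the leaves are the words of
length `r`. -/
abbrev PerfectTreeNode (r t : ℕ) : Type := {w : List (Fin t) // w.length ≤ r}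

/-- The perfect `t`-ary tree of depth `r`. -/
def perfectTree (r t : ℕ) : SimpleGraph (PerfectTreeNode r t) where
  Adj u v := (∃ a, v.1 = a :: u.1) ∨ (∃ a, u.1 = a :: v.1)
  symm := ⟨fun _ _ h => h.symm⟩
  loopless := ⟨fun u h => by
    rcases h with ⟨a, h⟩ | ⟨a, h⟩ <;> simpa using congrArg List.length h⟩

/-- The identification of corresponding leaves in `n` copies of the perfect `t`-ary tree of
depth `r`; the pair `(i, u)` is the node `u` of the `i`-th copy. -/
def gluedTreeSetoid (n r t : ℕ) : Setoid (Fin n × PerfectTreeNode r t) where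
  r x y := x.2 = y.2 ∧ (x.1 = y.1 ∨ x.2.1.length = r)
  iseqv :=
    { refl := fun _ => ⟨rfl, Or.inl rfl⟩
      symm := by
        rintro ⟨i, u⟩ ⟨j, v⟩ ⟨h, h'⟩
        dsimp only at h h' ⊢
        subst h
        exact ⟨rfl, h'.imp Eq.symm id⟩
      trans := by
        rintro ⟨i, u⟩ ⟨j, v⟩ ⟨k, w⟩ ⟨h, h'⟩ ⟨g, g'⟩
        dsimp only at h h' g g' ⊢
        subst h
        subst g
        refine ⟨rfl, ?_⟩
        rcases h' with rfl | h'
        · exact g'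
        · exact Or.inr h' }

/-- The vertices of the generalized glued `t`-ary tree. -/
abbrev GluedTreeVertex (n r t : ℕ) : Type := Quotient (gluedTreeSetoid n r t)

instance instFinitePerfectTreeNode (r t : ℕ) : Finite (PerfectTreeNode r t) :=
  (List.finite_length_le (Fin t) r).to_subtype

/-- The generalized glued `t`-ary tree `GT_{r,t}^{(n)}`: the graph obtained from `n` copies of the
perfect `t`-ary tree of depth `r` by identifying corresponding leaves. -/
def gluedTree (n r t : ℕ) : SimpleGraph (GluedTreeVertex n r t) where
  Adj x y := ∃ (i : Fin n) (u v : PerfectTreeNode r t), (perfectTree r t).Adj u v ∧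
    x = Quotient.mk _ (i, u) ∧ y = Quotient.mk _ (i, v)
  symm := ⟨by
    rintro x y ⟨i, u, v, h, hx, hy⟩
    exact ⟨i, v, u, h.symm, hy, hx⟩⟩
  loopless := ⟨by
    rintro x ⟨i, u, v, h, hx, hy⟩
    exact h.ne (Quotient.exact (hx.symm.trans hy)).1⟩

/-! Number the nodes level by level and give the `h`-th nodes of the `n` copies consecutive triples
of labels for their child edges. An interior node then sees a triple `x+1, x+2, x+3` and a parent
label `p`; this is sum-distinct when `3 ≤ p < x` (`sumFreeQuadruple_consecutive`). A leaf sees `y,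
y+3, y+6, y+9`, cut off at `n` terms; only `y + (y+9) = (y+3) + (y+6)` is harmful for large `y`, and
rotating the letters in the fourth copy destroys it (`sumDistinct_levelLabel`). What fails is near
the root: `1 + 2 = 3` at the first root, parent labels 1 and 2 below it, and some leaves when `r =
1`. `topSwap` repairs this by permuting labels up to `12 * n`, so the remaining verification is
finite. -/

/-! ### Sum-distinct families of at most four numbers. -/

/-- A family of natural numbers is *sum-distinct* if distinct finite subfamilies have distinct
sums. -/
def SumDistinct {ι : Type*} (c : ι → ℕ) : Prop :=
  ∀ S T : Finset ι, ∑ i ∈ S, c i = ∑ i ∈ T, c i → S = T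

theorem SumDistinct.injective {ι : Type*} {c : ι → ℕ} (h : SumDistinct c) :
    Function.Injective c := fun i j hij => by
  simpa using h {i} {j} (by simpa using hij)

theorem SumDistinct.comp {ι κ : Type*} {c : κ → ℕ} (h : SumDistinct c) {g : ι → κ}
    (hg : Function.Injective g) : SumDistinct (c ∘ g) := fun S T hST => by
  have := h (S.map ⟨g, hg⟩) (T.map ⟨g, hg⟩) (by simpa using hST)
  exact Finset.map_injective _ this

/-- The difference of two indicator functions has values in `{-1, 0, 1}`, so small families reduce
to a finite sign check. -/
theorem sumDistinct_of_signed {ι : Type*} [Fintype ι] {c : ι → ℕ}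
    (h : ∀ ε : ι → ℤ, (∀ i, ε i = -1 ∨ ε i = 0 ∨ ε i = 1) →
      ∑ i, ε i * c i = 0 → ∀ i, ε i = 0) : SumDistinct c := by
  classical
  intro S T hST
  have key := h (fun i => (if i ∈ S then 1 else 0) - (if i ∈ T then 1 else 0))
    (fun i => by by_cases h1 : i ∈ S <;> by_cases h2 : i ∈ T <;> simp [h1, h2])
    (by
      have := congrArg (Nat.cast : ℕ → ℤ) hST
      push_cast at this
      simp only [sub_mul, Finset.sum_sub_distrib, ite_mul, one_mul, zero_mul, Finset.sum_ite_mem,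
        Finset.univ_inter]
      exact sub_eq_zero.2 this)
  ext i
  have := key i
  by_cases h1 : i ∈ S <;> by_cases h2 : i ∈ T <;> simp_all

theorem sumDistinct_fin_one {c : Fin 1 → ℕ} (h : 0 < c 0) : SumDistinct c := by
  refine sumDistinct_of_signed fun ε hε hs i => ?_
  have h0 := hε 0
  simp only [Fin.sum_univ_one] at hs
  fin_cases i
  simpa [h.ne'] using hs

theorem sumDistinct_fin_two {c : Fin 2 → ℕ} (h : 0 < c 0 ∧ 0 < c 1 ∧ c 0 ≠ c 1) :
    SumDistinct c := by
  refine sumDistinct_of_signed fun ε hε hs => ?_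
  have h0 := hε 0
  have h1 := hε 1
  simp only [Fin.sum_univ_two] at hs
  rw [Fin.forall_fin_two]
  rcases h0 with h0 | h0 | h0 <;> rcases h1 with h1 | h1 | h1 <;>
    rw [h0, h1] at hs ⊢ <;> omega

/-- Three pairwise distinct positive integers, none of which is the sum of the others. -/
def SumFreeTriple (a b c : ℕ) : Prop :=
  (0 < a ∧ 0 < b ∧ 0 < c) ∧ (a ≠ b ∧ a ≠ c ∧ b ≠ c) ∧ (a + b ≠ c ∧ a + c ≠ b ∧ b + c ≠ a)

instance (a b c : ℕ) : Decidable (SumFreeTriple a b c) := by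
  unfold SumFreeTriple; infer_instance

theorem sumDistinct_fin_three {c : Fin 3 → ℕ} (h : SumFreeTriple (c 0) (c 1) (c 2)) :
    SumDistinct c := by
  refine sumDistinct_of_signed fun ε hε hs => ?_
  have h0 := hε 0
  have h1 := hε 1
  have h2 := hε 2
  unfold SumFreeTriple at h
  simp only [Fin.sum_univ_three] at hs
  rw [Fin.forall_fin_succ, Fin.forall_fin_two]
  change ε 0 = 0 ∧ ε 1 = 0 ∧ ε 2 = 0
  rcases h0 with h0 | h0 | h0 <;> rcases h1 with h1 | h1 | h1 <;> rcases h2 with h2 | h2 | h2 <;>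
    rw [h0, h1, h2] at hs ⊢ <;> omega

/-- Four positive integers all of whose triples are sum-free, none of which is the sum of the three
others, and which do not split into two pairs of equal sums. -/
def SumFreeQuadruple (a b c d : ℕ) : Prop :=
  SumFreeTriple a b c ∧ SumFreeTriple a b d ∧ SumFreeTriple a c d ∧ SumFreeTriple b c d ∧
    (a + b + c ≠ d ∧ a + b + d ≠ c ∧ a + c + d ≠ b ∧ b + c + d ≠ a) ∧
    (a + b ≠ c + d ∧ a + c ≠ b + d ∧ a + d ≠ b + c)

instance (a b c d : ℕ) : Decidable (SumFreeQuadruple a b c d) := by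
  unfold SumFreeQuadruple; infer_instance

set_option maxHeartbeats 2000000 in
theorem sumDistinct_fin_four {c : Fin 4 → ℕ} (h : SumFreeQuadruple (c 0) (c 1) (c 2) (c 3)) :
    SumDistinct c := by
  refine sumDistinct_of_signed fun ε hε hs => ?_
  have h0 := hε 0
  have h1 := hε 1
  have h2 := hε 2
  have h3 := hε 3
  unfold SumFreeQuadruple SumFreeTriple at h
  simp only [Fin.sum_univ_four] at hs
  rw [Fin.forall_fin_succ, Fin.forall_fin_succ, Fin.forall_fin_two]
  change ε 0 = 0 ∧ ε 1 = 0 ∧ ε 2 = 0 ∧ ε 3 = 0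
  rcases h0 with h0 | h0 | h0 <;> rcases h1 with h1 | h1 | h1 <;>
    rcases h2 with h2 | h2 | h2 <;> rcases h3 with h3 | h3 | h3 <;>
    rw [h0, h1, h2, h3] at hs ⊢ <;> grind

/-- The enumeration `e` only has to cover the incident edges: its injectivity follows from
sum-distinctness. -/
theorem isARVertex_of_sumDistinct {V ι : Type*} {G : SimpleGraph V} {f : G.edgeSet → ℕ} {v : V}
    (e : ι → G.edgeSet) (he : ∀ x : G.edgeSet, v ∈ x.1 → ∃ i, e i = x)
    (h : SumDistinct (f ∘ e)) : IsARVertex G f v := by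
  classical
  have hinj : Function.Injective e := h.injective.of_comp
  have key : ∀ S : Finset G.edgeSet, (∀ x ∈ S, v ∈ x.1) →
      ∃ S' : Finset ι, S'.map ⟨e, hinj⟩ = S := fun S hS => by
    refine ⟨S.preimage e hinj.injOn, ?_⟩
    ext x
    simp only [Finset.mem_map, Finset.mem_preimage, Function.Embedding.coeFn_mk]
    constructor
    · rintro ⟨i, hi, rfl⟩
      exact hi
    · intro hx
      obtain ⟨i, rfl⟩ := he x (hS x hx)
      exact ⟨i, hx, rfl⟩
  intro S T hS hT hST
  obtain ⟨S', rfl⟩ := key S hS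
  obtain ⟨T', rfl⟩ := key T hT
  rw [h S' T' (by simpa using hST)]

/-! ### Level order on words and the encoding of the edges. -/

/-- The position of a word in the enumeration of ternary words by length. -/
def wordIndex : List (Fin 3) → ℕ
  | [] => 0
  | a :: w => 3 * wordIndex w + a + 1

/-- The number of ternary words of length less than `r`. -/
def wordCount : ℕ → ℕ
  | 0 => 0
  | r + 1 => 3 * wordCount r + 1

theorem wordIndex_lt_iff (w : List (Fin 3)) (r : ℕ) :
    wordIndex w < wordCount r ↔ w.length < r := by
  induction r generalizing w with
  | zero => simp [wordCount]
  | succ r ih =>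
    cases w with
    | nil => simp [wordCount, wordIndex]
    | cons a w =>
      have := ih w
      simp only [wordCount, wordIndex, List.length_cons]
      omega

theorem wordIndex_injective : Function.Injective wordIndex := by
  intro v
  induction v with
  | nil => intro w h; cases w <;> simp_all [wordIndex]
  | cons a v ih =>
    intro w h
    cases w with
    | nil => simp [wordIndex] at h
    | cons b w =>
      simp only [wordIndex] at h
      have hab : a = b := Fin.ext (by omega)
      rw [hab, ih (a₂ := w) (by omega)]

theorem wordIndex_surjective : Function.Surjective wordIndex := by
  intro k
  induction k using Nat.strong_induction_on with
  | _ k ih =>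
    rcases k with _ | k
    · exact ⟨[], rfl⟩
    · obtain ⟨w, hw⟩ := ih (k / 3) (by omega)
      refine ⟨⟨k % 3, by omega⟩ :: w, ?_⟩
      simp only [wordIndex, hw]
      omega

theorem card_words_lt (r : ℕ) : Nat.card {w : List (Fin 3) // w.length < r} = wordCount r := by
  have e : {w : List (Fin 3) // w.length < r} ≃ {k : ℕ // k < wordCount r} :=
    (Equiv.ofBijective _ ⟨wordIndex_injective, wordIndex_surjective⟩).subtypeEquiv
      fun w => (wordIndex_lt_iff w r).symm
  rw [Nat.card_congr (e.trans Fin.equivSubtype.symm), Nat.card_fin]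

/-- The triple `(i, w, a)` encodes the edge from `w` to its child `a :: w` in the `i`-th copy of
the perfect ternary tree. -/
abbrev GluedEdge (n r : ℕ) : Type := Fin n × {w : List (Fin 3) // w.length < r} × Fin 3

/-- The edge encoded by a triple. -/
def GluedEdge.toEdge {n r : ℕ} (x : GluedEdge n r) : (gluedTree n r 3).edgeSet :=
  ⟨s(Quotient.mk _ (x.1, ⟨x.2.1.1, x.2.1.2.le⟩),
      Quotient.mk _ (x.1, ⟨x.2.2 :: x.2.1.1, x.2.1.2⟩)),
    x.1, _, _, Or.inl ⟨x.2.2, rfl⟩, rfl, rfl⟩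

theorem GluedEdge.toEdge_surjective {n r : ℕ} :
    Function.Surjective (GluedEdge.toEdge : GluedEdge n r → _) := by
  rintro ⟨x, hx⟩
  induction x with
  | _ x y =>
    obtain ⟨i, ⟨u, hu⟩, ⟨v, hv⟩, h, hx, hy⟩ := hx
    dsimp only at hx hy
    subst hx hy
    rcases h with ⟨a, h⟩ | ⟨a, h⟩
    · dsimp only at h
      subst h
      exact ⟨(i, ⟨u, hv⟩, a), rfl⟩
    · dsimp only at h
      subst h
      exact ⟨(i, ⟨v, hu⟩, a), Subtype.ext Sym2.eq_swap⟩

theorem gluedTree_mk_eq {n r : ℕ} {i j : Fin n} {u v : PerfectTreeNode r 3}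
    (h : (Quotient.mk (gluedTreeSetoid n r 3) (i, u)) = Quotient.mk _ (j, v)) :
    u.1 = v.1 ∧ (i = j ∨ u.1.length = r) :=
  have h' := Quotient.exact h
  ⟨congrArg Subtype.val h'.1, h'.2⟩

theorem GluedEdge.toEdge_injective {n r : ℕ} :
    Function.Injective (GluedEdge.toEdge : GluedEdge n r → _) := by
  rintro ⟨i, ⟨u, hu⟩, a⟩ ⟨j, ⟨v, hv⟩, b⟩ h
  have h' := congrArg Subtype.val h
  simp only [GluedEdge.toEdge, Sym2.eq_iff] at h'
  rcases h' with ⟨h1, h2⟩ | ⟨h1, h2⟩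
  · obtain ⟨h3, h4⟩ := gluedTree_mk_eq h1
    obtain ⟨h5, -⟩ := gluedTree_mk_eq h2
    obtain rfl : i = j := h4.resolve_right hu.ne
    simp_all
  · have h3 := congrArg List.length (gluedTree_mk_eq h1).1
    have h4 := congrArg List.length (gluedTree_mk_eq h2).1
    simp at h3 h4
    omega

theorem GluedEdge.mem_toEdge {n r : ℕ} {x : GluedEdge n r} {j : Fin n} {u : PerfectTreeNode r 3}
    (h : Quotient.mk (gluedTreeSetoid n r 3) (j, u) ∈ x.toEdge.1) :
    (j = x.1 ∧ u.1 = x.2.1.1) ∨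
      (u.1 = x.2.2 :: x.2.1.1 ∧ (j = x.1 ∨ u.1.length = r)) := by
  rcases Sym2.mem_iff.1 h with h | h
  · obtain ⟨h1, h2⟩ := gluedTree_mk_eq h
    refine Or.inl ⟨h2.resolve_right ?_, h1⟩
    rw [h1]
    exact x.2.1.2.ne
  · exact Or.inr (gluedTree_mk_eq h)

/-- The encoding of the edges as an equivalence. -/
noncomputable def gluedEdgeEquiv (n r : ℕ) : GluedEdge n r ≃ (gluedTree n r 3).edgeSet :=
  Equiv.ofBijective _ ⟨GluedEdge.toEdge_injective, GluedEdge.toEdge_surjective⟩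

/-- A labeling of the encoded edges with sum-distinct families at the roots, at the other interior
nodes and at the leaves gives an AR-labeling of the glued tree. -/
theorem isARGraph_gluedTree {n r : ℕ} (hr : 1 ≤ r) (L : Fin n → List (Fin 3) → Fin 3 → ℕ)
    (hpos : ∀ i w a, 0 < L i w a)
    (hle : ∀ i w a, w.length < r → L i w a ≤ 3 * (n * wordCount r))
    (hinj : ∀ i w a j v b, L i w a = L j v b → i = j ∧ w = v ∧ a = b)
    (hroot : ∀ i, SumDistinct (L i []))
    (hint : ∀ i b w, w.length + 1 < r →
      SumDistinct ![L i w b, L i (b :: w) 0, L i (b :: w) 1, L i (b :: w) 2])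
    (hleaf : ∀ b w, w.length + 1 = r → SumDistinct fun i => L i w b) :
    IsARGraph (gluedTree n r 3) := by
  let f : (gluedTree n r 3).edgeSet → ℕ := fun e =>
    let x := (gluedEdgeEquiv n r).symm e
    L x.1 x.2.1.1 x.2.2
  have hf : ∀ x : GluedEdge n r, f x.toEdge = L x.1 x.2.1.1 x.2.2 := fun x => by
    have : (gluedEdgeEquiv n r).symm x.toEdge = x := (gluedEdgeEquiv n r).symm_apply_apply x
    simp only [f, this]
  have hcard : Nat.card (gluedTree n r 3).edgeSet = 3 * (n * wordCount r) := by
    rw [← Nat.card_congr (gluedEdgeEquiv n r), Nat.card_prod, Nat.card_prod, card_words_lt,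
      Nat.card_fin, Nat.card_fin]
    ring
  refine ⟨f, ⟨fun e => hpos _ _ _, fun e e' h => ?_, fun v => ?_⟩, fun e => ?_⟩
  · obtain ⟨h1, h2, h3⟩ := hinj _ _ _ _ _ _ h
    exact (gluedEdgeEquiv n r).symm.injective (Prod.ext h1 (Prod.ext (Subtype.ext h2) h3))
  · induction v using Quotient.inductionOn with
    | _ v =>
    obtain ⟨j, u, hu⟩ := v
    rcases u with _ | ⟨b, w⟩
    · refine isARVertex_of_sumDistinct
        (fun a : Fin 3 => GluedEdge.toEdge (j, ⟨[], hr⟩, a)) ?_ ?_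
      · intro x hx
        obtain ⟨⟨i, ⟨w, hw⟩, a⟩, rfl⟩ := GluedEdge.toEdge_surjective x
        rcases GluedEdge.mem_toEdge hx with ⟨h1, h2⟩ | ⟨h1, -⟩
        · dsimp only at h1 h2
          subst h1 h2
          exact ⟨a, rfl⟩
        · simp at h1
      · convert hroot j using 1
        ext a
        exact hf _
    · rcases Nat.lt_or_ge (w.length + 1) r with hlt | hge
      · refine isARVertex_of_sumDistinct
          ![GluedEdge.toEdge (j, ⟨w, by omega⟩, b), GluedEdge.toEdge (j, ⟨b :: w, hlt⟩, 0),
            GluedEdge.toEdge (j, ⟨b :: w, hlt⟩, 1), GluedEdge.toEdge (j, ⟨b :: w, hlt⟩, 2)] ?_ ?_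
        · intro x hx
          obtain ⟨⟨i, ⟨v, hv⟩, a⟩, rfl⟩ := GluedEdge.toEdge_surjective x
          rcases GluedEdge.mem_toEdge hx with ⟨h1, h2⟩ | ⟨h1, h2⟩
          · dsimp only at h1 h2
            subst h1 h2
            refine ⟨a.succ, ?_⟩
            fin_cases a <;> rfl
          · have h2 := h2.resolve_right (by simpa using hlt.ne)
            dsimp only at h1 h2
            subst h2
            simp only [List.cons.injEq] at h1
            obtain ⟨rfl, rfl⟩ := h1
            exact ⟨0, rfl⟩
        · convert hint j b w hlt using 1
          ext a
          fin_cases a <;> exact hf _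
      · have hw : w.length + 1 = r := le_antisymm hu hge
        refine isARVertex_of_sumDistinct
          (fun i => GluedEdge.toEdge (i, ⟨w, by omega⟩, b)) ?_ ?_
        · intro x hx
          obtain ⟨⟨i, ⟨v, hv⟩, a⟩, rfl⟩ := GluedEdge.toEdge_surjective x
          rcases GluedEdge.mem_toEdge hx with ⟨-, h2⟩ | ⟨h1, -⟩
          · dsimp only at h2
            subst h2
            simp at hv
            omega
          · simp only [List.cons.injEq] at h1
            obtain ⟨rfl, rfl⟩ := h1
            exact ⟨i, rfl⟩
        · convert hleaf b w hw using 1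
          ext i
          exact hf _
  · rw [hcard]
    exact hle _ _ _ ((gluedEdgeEquiv n r).symm e).2.1.2

/-! ### The labeling and its verification. -/

/-- The cyclic shift of the letters in the fourth copy, the identity in the others. -/
def letterShift (i : ℕ) (a : Fin 3) : ℕ := if i = 3 then (a + 1) % 3 else a

/-- The labels in level order: the `h`-th nodes of the `n` copies receive consecutive triples. -/
def levelLabel (n i h : ℕ) (a : Fin 3) : ℕ := 3 * (n * h + i) + letterShift i a + 1

/-- The exchange of labels on the two top levels that repairs the nodes near the root. -/
def topSwap : ℕ → Equiv.Perm ℕ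
  -- The general rule would leave `1 + 6 = 7` at the first child of the root.
  | 1 => Equiv.swap 3 4 * Equiv.swap 6 10 * Equiv.swap 9 11
  -- For `r = 1`, exchanging 6 and 7 avoids `1 + 3 + 7 = 11` and `4 + 6 = 10` at leaves.
  | 4 => Equiv.swap 3 4 * Equiv.swap 6 7 * Equiv.swap 14 25
  -- The first swap repairs the first root; the second breaks up the triples below the edges labeled
  -- 1 and 2.
  | n => Equiv.swap 3 4 * Equiv.swap (3 * n + 2) (6 * n + 1)

/-- The label of the edge from the `h`-th node to its child `a` in the `i`-th copy. -/
def gluedLabel (n i h : ℕ) (a : Fin 3) : ℕ := topSwap n (levelLabel n i h a)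

theorem letterShift_lt (i : ℕ) (a : Fin 3) : letterShift i a < 3 := by
  unfold letterShift; split <;> omega

theorem letterShift_injective {i : ℕ} {a b : Fin 3} (h : letterShift i a = letterShift i b) :
    a = b := by
  unfold letterShift at h
  ext
  split at h <;> omega

theorem levelLabel_injective {n i h j k : ℕ} {a b : Fin 3} (hi : i < n) (hj : j < n)
    (e : levelLabel n i h a = levelLabel n j k b) : i = j ∧ h = k ∧ a = b := by
  have ha := letterShift_lt i a
  have hb := letterShift_lt j b
  unfold levelLabel at e
  have e' : n * h + i = n * k + j := by omega
  have hk : h = k := by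
    have := congrArg (· / n) e'
    simpa [Nat.mul_add_div (Nat.zero_lt_of_lt hi), Nat.div_eq_of_lt hi, Nat.div_eq_of_lt hj]
      using this
  subst hk
  obtain rfl : i = j := by omega
  exact ⟨rfl, rfl, letterShift_injective (i := i) (by omega)⟩

theorem topSwap_of_lt {n v : ℕ} (hn : 1 ≤ n) (hn4 : n ≤ 4) (hv : 12 * n < v) :
    topSwap n v = v := by
  interval_cases n <;>
    simp only [topSwap, Equiv.Perm.mul_apply] <;>
    iterate 3 try rw [Equiv.swap_apply_of_ne_of_ne (x := v) (by omega) (by omega)]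

theorem topSwap_zero {n : ℕ} (hn : 1 ≤ n) (hn4 : n ≤ 4) : topSwap n 0 = 0 := by
  interval_cases n <;> decide

/-- The last two bounds keep a parent label below depth one at least 3 and smaller than the triple
under it. -/
theorem topSwap_bounds {n : ℕ} (hn : 1 ≤ n) (hn4 : n ≤ 4) :
    ∀ v < 12 * n + 1, topSwap n v ≤ 12 * n ∧
      (4 ≤ v → 3 ≤ topSwap n v ∧ topSwap n v + 4 ≤ v + 9 * n) := by
  interval_cases n <;> decide

/-- Needed for `r = 1`, where only the labels up to `3 * n` are available; for `n = 1` it fails,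
since 3 goes to 4. -/
theorem topSwap_le_top {n : ℕ} (hn : 2 ≤ n) (hn4 : n ≤ 4) :
    ∀ v < 3 * n + 1, topSwap n v ≤ 3 * n := by
  interval_cases n <;> decide

theorem gluedLabel_root {n : ℕ} (hn : 1 ≤ n) (hn4 : n ≤ 4) : ∀ i < n,
    SumFreeTriple (gluedLabel n i 0 0) (gluedLabel n i 0 1) (gluedLabel n i 0 2) := by
  interval_cases n <;> decide

theorem gluedLabel_depth_one {n : ℕ} (hn : 1 ≤ n) (hn4 : n ≤ 4) : ∀ i < n, ∀ b : Fin 3,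
    SumFreeQuadruple (gluedLabel n i 0 b) (gluedLabel n i (b + 1) 0)
      (gluedLabel n i (b + 1) 1) (gluedLabel n i (b + 1) 2) := by
  interval_cases n <;> decide

theorem gluedLabel_two_leaf : ∀ h < 4, ∀ a : Fin 3,
    0 < gluedLabel 2 0 h a ∧ 0 < gluedLabel 2 1 h a ∧ gluedLabel 2 0 h a ≠ gluedLabel 2 1 h a := by
  decide

theorem gluedLabel_three_leaf : ∀ h < 4, ∀ a : Fin 3,
    SumFreeTriple (gluedLabel 3 0 h a) (gluedLabel 3 1 h a) (gluedLabel 3 2 h a) := by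
  decide

theorem gluedLabel_four_leaf : ∀ h < 4, ∀ a : Fin 3,
    SumFreeQuadruple (gluedLabel 4 0 h a) (gluedLabel 4 1 h a) (gluedLabel 4 2 h a)
      (gluedLabel 4 3 h a) := by
  decide

theorem gluedLabel_of_four_le {n i h : ℕ} (a : Fin 3) (hn : 1 ≤ n) (hn4 : n ≤ 4) (hh : 4 ≤ h) :
    gluedLabel n i h a = levelLabel n i h a := by
  refine topSwap_of_lt hn hn4 ?_
  have : n * 4 ≤ n * h := Nat.mul_le_mul_left n hh
  unfold levelLabel
  omega

theorem gluedLabel_pos {n i h : ℕ} (a : Fin 3) (hn : 1 ≤ n) (hn4 : n ≤ 4) :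
    0 < gluedLabel n i h a := by
  refine Nat.pos_of_ne_zero fun h0 => ?_
  have := (topSwap n).injective (h0.trans (topSwap_zero hn hn4).symm)
  simp [levelLabel] at this

theorem sumDistinct_levelLabel {n h : ℕ} (a : Fin 3) (hn : 1 ≤ n) (hh : 4 ≤ h) :
    SumDistinct fun i : Fin 4 => levelLabel n i h a := by
  -- All labels are now at least 13, so any two of the four outweigh a third.
  have : 4 ≤ n * h := by nlinarith
  refine sumDistinct_fin_four ?_
  simp only [SumFreeQuadruple, SumFreeTriple, levelLabel, letterShift]
  fin_cases a <;> simp <;> omega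

theorem sumDistinct_leaf {n h : ℕ} (a : Fin 3) (hn : 1 ≤ n) (hn4 : n ≤ 4) :
    SumDistinct fun i : Fin n => gluedLabel n i h a := by
  rcases Nat.lt_or_ge h 4 with hh | hh
  · interval_cases n
    · exact sumDistinct_fin_one (gluedLabel_pos a (by omega) (by omega))
    · exact sumDistinct_fin_two (gluedLabel_two_leaf h hh a)
    · exact sumDistinct_fin_three (gluedLabel_three_leaf h hh a)
    · exact sumDistinct_fin_four (gluedLabel_four_leaf h hh a)
  · simp only [gluedLabel_of_four_le a hn hn4 hh]
    -- The formula is sum-distinct over four indices even if fewer copies exist.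
    exact (sumDistinct_levelLabel a hn hh).comp (Fin.castLE_injective hn4)

theorem sumFreeQuadruple_consecutive {p x : ℕ} (hp : 3 ≤ p) (hx : p < x) (y : Fin 3 → ℕ)
    (hy : ∀ a, x < y a ∧ y a ≤ x + 3) (hinj : Function.Injective y) :
    SumFreeQuadruple p (y 0) (y 1) (y 2) := by
  have h0 := hy 0
  have h1 := hy 1
  have h2 := hy 2
  have h01 := hinj.ne (show (0 : Fin 3) ≠ 1 by decide)
  have h02 := hinj.ne (show (0 : Fin 3) ≠ 2 by decide)
  have h12 := hinj.ne (show (1 : Fin 3) ≠ 2 by decide)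
  simp only [SumFreeQuadruple, SumFreeTriple]
  omega

theorem gluedLabel_interior {n i k : ℕ} (b : Fin 3) (hn : 1 ≤ n) (hn4 : n ≤ 4) (hi : i < n) :
    SumFreeQuadruple (gluedLabel n i k b) (gluedLabel n i (3 * k + b + 1) 0)
      (gluedLabel n i (3 * k + b + 1) 1) (gluedLabel n i (3 * k + b + 1) 2) := by
  rcases Nat.eq_zero_or_pos k with rfl | hk
  · simpa using gluedLabel_depth_one hn hn4 i hi b
  have hh : 4 ≤ 3 * k + b + 1 := by omega
  simp only [gluedLabel_of_four_le _ hn hn4 hh]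
  have hkn : n * 1 ≤ n * k := Nat.mul_le_mul_left n hk
  have hb := letterShift_lt i b
  have hb' : 0 ≤ n * (b : ℕ) := Nat.zero_le _
  have hexp : n * (3 * k + b + 1) = 3 * (n * k) + n * b + n := by ring
  have hp : 3 ≤ gluedLabel n i k b ∧ gluedLabel n i k b < 3 * (n * (3 * k + b + 1) + i) := by
    rw [hexp]
    rcases Nat.lt_or_ge (12 * n) (levelLabel n i k b) with hv | hv
    · rw [gluedLabel, topSwap_of_lt hn hn4 hv]
      unfold levelLabel at hv ⊢
      omega
    · have := (topSwap_bounds hn hn4 _ (Nat.lt_succ_of_le hv)).2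
        (by unfold levelLabel; omega)
      unfold gluedLabel
      refine ⟨this.1, ?_⟩
      have h2 := this.2
      generalize topSwap n (levelLabel n i k b) = q at *
      unfold levelLabel at *
      omega
  refine sumFreeQuadruple_consecutive hp.1 hp.2
    (levelLabel n i (3 * k + b + 1)) (fun a => ?_) fun a a' h => (levelLabel_injective hi hi h).2.2
  have := letterShift_lt i a
  unfold levelLabel
  omega

theorem gluedLabel_le {n r i h : ℕ} (a : Fin 3) (hn : 1 ≤ n) (hn4 : n ≤ 4) (hr : 1 ≤ r)
    (hne : ¬(n = 1 ∧ r = 1)) (hi : i < n) (hh : h < wordCount r) :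
    gluedLabel n i h a ≤ 3 * (n * wordCount r) := by
  have hv : levelLabel n i h a ≤ 3 * (n * wordCount r) := by
    have h1 : n * (h + 1) ≤ n * wordCount r := Nat.mul_le_mul_left n hh
    have h2 := letterShift_lt i a
    unfold levelLabel
    rw [mul_add] at h1
    omega
  unfold gluedLabel
  obtain _ | _ | r := r
  · omega
  · simp only [wordCount] at hv ⊢
    have := topSwap_le_top (n := n) (by omega) hn4 _ (Nat.lt_succ_of_le (by simpa using hv))
    simpa using this
  · rcases Nat.lt_or_ge (12 * n) (levelLabel n i h a) with hlt | hge
    · rwa [topSwap_of_lt hn hn4 hlt]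
    · refine (topSwap_bounds hn hn4 _ (Nat.lt_succ_of_le hge)).1.trans ?_
      have : n * 4 ≤ n * wordCount (r + 1 + 1) :=
        Nat.mul_le_mul_left n (by simp only [wordCount]; omega)
      omega

theorem theorem8 (n r : ℕ) (hn : 1 ≤ n) (hn4 : n ≤ 4) (hr : 1 ≤ r)
    (hne : ¬(n = 1 ∧ r = 1)) :
    IsARGraph (gluedTree n r 3) := by
  refine isARGraph_gluedTree hr (fun i w a => gluedLabel n i (wordIndex w) a)
    (fun i w a => gluedLabel_pos a hn hn4)
    (fun i w a hw => gluedLabel_le a hn hn4 hr hne i.2 ((wordIndex_lt_iff w r).2 hw))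
    (fun i w a j v b h => ?_)
    (fun i => sumDistinct_fin_three (gluedLabel_root hn hn4 i i.2))
    (fun i b w _ => sumDistinct_fin_four (gluedLabel_interior b hn hn4 i.2))
    (fun b w _ => sumDistinct_leaf b hn hn4)
  obtain ⟨h1, h2, h3⟩ := levelLabel_injective i.2 j.2 ((topSwap n).injective h)
  exact ⟨Fin.ext h1, wordIndex_injective h2, h3⟩
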